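/- All graphs are finite, simple and undirected. For a $d$-regular graph $H$ let $\lambda(H)$ be the maximum of $|\mu|$ over the adjacency eigenvalues $\mu\neq\pm d$ of $H$ (and $0$ if there are none). A graph $H$ is called Ramanujan if it is connected and $d$-regular for some $d\ge 1$, and $\lambda(H)\le 2\sqrt{d-1}$. (The one-vertex graph is thus not Ramanujan.) Let $G^{\boxtimes k}$ denote the $k$-fold strong power of $G$, and let $$\theta(G)=\min_{u,c}\ \max_{i\in V(G)}\ \frac{1}{(c^{\mathsf T}u_i)^2}$$ be the Lovász $\theta$-function, where the minimum is over all unit vectors $c$ and all assignments $u$ of unit vectors $u_i$ to the vertices, in some $\mathbb{R}^m$, such that $u_i\perp u_j$ for distinct non-adjacent $i,j$. **Proposition.** Let $G$ be a connected $d$-regular graph on $n$ vertices which is non-empty (has an edge) and non-complete. If $$\theta(G)<\frac{n}{\sqrt{d+1}},$$ then, with $$k_0=\max\left\{3,\ \left\lceil\frac{\log\bigl(2+(d+1)^{-3/2}\bigr)+\log\Bigl(\frac{n^3}{n^3-(d+1)^3}\Bigr)}{\log\Bigl(\frac{n}{\theta(G)\sqrt{d+1}}\Bigr)}\right\rceil\right\},$$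 for all $k\ge k_0$ the strong power $G^{\boxtimes k}$ is connected and regular of valency $d_k=(d+1)^k-1$ but is not Ramanujan. It is in fact highly non-Ramanujan: there is $\rho>1$ such that $\lambda(G^{\boxtimes k})\ge \rho^k\cdot 2\sqrt{d_k-1}$ for all $k\ge k_0$. This applies, in particular, to all self-complementary vertex-transitive graphs $G$ on $n>1$ vertices: such a graph is connected, regular, non-empty and non-complete, it satisfies the above condition on $\theta(G)$, and either $n=5$ and $k_0=5$, or $n=9$ and $k_0=4$, or $n\ge 13$, $n\equiv 1 \pmod 4$ and $k_0=3$. If $n=1$, then $G^{\boxtimes k}$ is non-Ramanujan for all $k\ge 1$. -/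

import Mathlib

namespace SimpleGraph

/-- The strong product of two graphs. -/
def strongProd {V W : Type*} (G : SimpleGraph V) (H : SimpleGraph W) :
    SimpleGraph (V × W) where
  Adj x y := (x.1 = y.1 ∧ H.Adj x.2 y.2) ∨ (G.Adj x.1 y.1 ∧ x.2 = y.2) ∨
    (G.Adj x.1 y.1 ∧ H.Adj x.2 y.2)
  symm.symm x y h := by
    rcases h with ⟨h₁, h₂⟩ | ⟨h₁, h₂⟩ | ⟨h₁, h₂⟩
    · exact Or.inl ⟨h₁.symm, h₂.symm⟩
    · exact Or.inr (Or.inl ⟨h₁.symm, h₂.symm⟩)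
    · exact Or.inr (Or.inr ⟨h₁.symm, h₂.symm⟩)
  loopless.irrefl x h := by
    rcases h with ⟨_, h⟩ | ⟨h, _⟩ | ⟨h, _⟩ <;> exact h.ne rfl

/-- The `k`-fold strong power of `G`, on the `k`-tuples of vertices: two distinct tuples are
adjacent iff in every coordinate their entries are equal or adjacent.  By `strongPowerOneIso` and
`strongPowerSuccIso` below, this is the iterated strong product of `k` copies of `G`. -/
def strongPower {V : Type*} (G : SimpleGraph V) (k : ℕ) : SimpleGraph (Fin k → V) where
  Adj x y := x ≠ y ∧ ∀ i, x i = y i ∨ G.Adj (x i) (y i)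
  symm.symm _ _ h := ⟨h.1.symm, fun i => (h.2 i).imp Eq.symm (fun a => a.symm)⟩
  loopless.irrefl _ h := h.1 rfl

theorem strongProd_adj_iff {V W : Type*} (G : SimpleGraph V) (H : SimpleGraph W) (x y : V × W) :
    (G.strongProd H).Adj x y ↔
      x ≠ y ∧ (x.1 = y.1 ∨ G.Adj x.1 y.1) ∧ (x.2 = y.2 ∨ H.Adj x.2 y.2) := by
  have hG : x.1 = y.1 → ¬ G.Adj x.1 y.1 := fun h a => a.ne h
  have hH : x.2 = y.2 → ¬ H.Adj x.2 y.2 := fun h a => a.ne h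
  simp only [strongProd, ne_eq, Prod.ext_iff]
  tauto

/-- The first strong power of `G` is `G`. -/
def strongPowerOneIso {V : Type*} (G : SimpleGraph V) : G.strongPower 1 ≃g G where
  toEquiv := Equiv.funUnique (Fin 1) V
  map_rel_iff' {x y} := by
    have hG : x 0 = y 0 → ¬ G.Adj (x 0) (y 0) := fun h a => a.ne h
    simp only [strongPower, Equiv.funUnique_apply, Fin.default_eq_zero, ne_eq, funext_iff,
      Fin.forall_fin_one]
    tauto

/-- The `(k + 1)`-st strong power of `G` is the strong product of `G` and the `k`-th power. -/
def strongPowerSuccIso {V : Type*} (G : SimpleGraph V) (k : ℕ) :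
    G.strongPower (k + 1) ≃g G.strongProd (G.strongPower k) where
  toEquiv := (Fin.consEquiv (fun _ : Fin (k + 1) => V)).symm
  map_rel_iff' {x y} := by
    rw [strongProd_adj_iff]
    have hx : Fin.tail x = Fin.tail y ↔ ∀ i : Fin k, x i.succ = y i.succ := by
      simp [funext_iff, Fin.tail]
    have hxy : x = y ↔ x 0 = y 0 ∧ ∀ i : Fin k, x i.succ = y i.succ := by
      simp [funext_iff, Fin.forall_fin_succ]
    have hall : (∀ i : Fin k, x i.succ = y i.succ) →
        ∀ i : Fin k, x i.succ = y i.succ ∨ G.Adj (x i.succ) (y i.succ) :=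
      fun h i => Or.inl (h i)
    simp only [strongPower, Fin.consEquiv, Equiv.coe_fn_symm_mk, ne_eq, Prod.ext_iff, hx, hxy,
      Fin.forall_fin_succ]
    simp only [Fin.tail]
    tauto

/-- `u` is an orthonormal representation of `G`: unit vectors are assigned to the vertices, and
vectors of distinct non-adjacent vertices are orthogonal. -/
def IsOrthonormalRep {V : Type*} (G : SimpleGraph V) {m : ℕ}
    (u : V → EuclideanSpace ℝ (Fin m)) : Prop :=
  (∀ i, ‖u i‖ = 1) ∧ ∀ i j, i ≠ j → ¬ G.Adj i j → inner ℝ (u i) (u j) = 0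

/-- The Lovász theta function: the infimum of `max_i 1 / ⟨c, u i⟩ ^ 2` over all orthonormal
representations `u` (in any finite dimension) and all unit vectors `c`.  Pairs with some
`⟨c, u i⟩ = 0`, for which this maximum is infinite, are left out. -/
noncomputable def lovaszTheta {V : Type*} (G : SimpleGraph V) : ℝ :=
  sInf {t : ℝ | ∃ (m : ℕ) (u : V → EuclideanSpace ℝ (Fin m)) (c : EuclideanSpace ℝ (Fin m)),
    G.IsOrthonormalRep u ∧ ‖c‖ = 1 ∧ (∀ i, inner ℝ c (u i) ≠ 0) ∧
    t = ⨆ i, 1 / (inner ℝ c (u i)) ^ 2}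

open Classical in
/-- For a `d`-regular graph `G`, the largest absolute value of an adjacency eigenvalue other than
`d` and `-d` (and `0` if there is none). -/
noncomputable def lambdaNontrivial {V : Type*} [Fintype V] (G : SimpleGraph V) (d : ℕ) : ℝ :=
  sSup {x : ℝ | ∃ μ ∈ spectrum ℝ (G.adjMatrix ℝ), μ ≠ (d : ℝ) ∧ μ ≠ -(d : ℝ) ∧ x = |μ|}

open Classical in
/-- A Ramanujan graph: a connected `d`-regular graph with `λ(G) ≤ 2 √(d - 1)`.  The condition
`1 ≤ d` says that the right-hand side is a real number; it only excludes the one-vertex graph. -/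
def IsRamanujan {V : Type*} [Fintype V] (G : SimpleGraph V) : Prop :=
  ∃ d : ℕ, 1 ≤ d ∧ G.Connected ∧ G.IsRegularOfDegree d ∧
    G.lambdaNontrivial d ≤ 2 * Real.sqrt ((d : ℝ) - 1)

/-- `G` and its complement are isomorphic. -/
def IsSelfComplementary {V : Type*} (G : SimpleGraph V) : Prop :=
  Nonempty (G ≃g Gᶜ)

/-- Every vertex can be mapped to every other one by an automorphism. -/
def IsVertexTransitive {V : Type*} (G : SimpleGraph V) : Prop :=
  ∀ u v : V, ∃ φ : G ≃g G, φ u = v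

open Classical in
/-- For a `d`-regular graph `G`: from the `k₀`-th on, all strong powers of `G` are connected and
regular of valency `d_k = (d + 1) ^ k - 1` but not Ramanujan, and highly so: `λ` of the `k`-th
power exceeds the Ramanujan bound `2 √(d_k - 1)` by a factor that is exponential in `k`. -/
def StrongPowersHighlyNonRamanujan {V : Type*} [Fintype V] (G : SimpleGraph V)
    (d k₀ : ℕ) : Prop :=
  (∀ k, k₀ ≤ k → (G.strongPower k).Connected ∧
    (G.strongPower k).IsRegularOfDegree ((d + 1) ^ k - 1) ∧
    ¬ (G.strongPower k).IsRamanujan) ∧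
  ∃ ρ : ℝ, 1 < ρ ∧ ∀ k, k₀ ≤ k →
    ρ ^ k * (2 * Real.sqrt (((d : ℝ) + 1) ^ k - 1 - 1)) ≤
      (G.strongPower k).lambdaNontrivial ((d + 1) ^ k - 1)

/-- The explicit threshold `k₀`, for order `n`, valency `d` and theta function `θ`. -/
noncomputable def ramanujanThreshold (n d : ℕ) (θ : ℝ) : ℕ :=
  max 3 ⌈(Real.log (2 + ((d : ℝ) + 1) ^ (-(3 / 2) : ℝ)) +
      Real.log ((n : ℝ) ^ 3 / ((n : ℝ) ^ 3 - ((d : ℝ) + 1) ^ 3))) /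
    Real.log ((n : ℝ) / (θ * Real.sqrt ((d : ℝ) + 1)))⌉₊

end SimpleGraph

/-! Write `D = d + 1` and let `A` be the adjacency matrix of `G`. Closed neighbourhoods in a strong
power are products of closed neighbourhoods, so `A + 1` is tensored. An eigenvalue `L` of `A + 1`
therefore gives the eigenvalue `L * D ^ (k - 1) - 1` of the `k`-th power, whose Ramanujan bound is
below `2 * √D ^ k`. Since `D > √D`, any nontrivial `L > 0` eventually wins; the explicit threshold
needs a lower bound on `L`.

That bound is Hoffman's, applied to the complement: if `-L` is the least eigenvalue of `Gᶜ`, then `n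
- D ≤ L * (θ - 1)` (`card_sub_le_mul_lovaszTheta_sub_one`). Its eigenvector is orthogonal to the
constants, so it is also an eigenvector of `A + 1`, with eigenvalue `L < D`
(`exists_eigenvector_lovaszTheta`). An induction raises the bound to `n ^ k - D ^ k ≤ L * D ^ (k -
1) * (θ ^ k - 1)`, and the inequality defining the threshold turns this into `L * D ^ (k - 1) - 1 >
2 * √D ^ k`.

For self-complementary vertex-transitive graphs `θ = √n`. The lower bound comes from tensoring a
representation with its image under an isomorphism to the complement. The upper bound comes from
`θ(G) * θ(Gᶜ) ≤ n`, for which an optimal dual matrix is averaged over the automorphism group; strong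
duality is proved by separating convex sets. Then `n = 2 * D - 1`, and the thresholds reduce to
numerical estimates. -/

/-! ### Positive semidefinite real matrices -/

open scoped MatrixOrder in
/-- Every positive semidefinite real matrix is a Gram matrix. -/
theorem Matrix.PosSemidef.exists_gram {V : Type*} [Fintype V] {M : Matrix V V ℝ}
    (hM : M.PosSemidef) :
    ∃ v : V → EuclideanSpace ℝ V, ∀ i j, inner ℝ (v i) (v j) = M i j := by
  classical
  obtain ⟨B, rfl⟩ := CStarAlgebra.nonneg_iff_eq_star_mul_self.mp hM.nonneg
  refine ⟨fun i => WithLp.toLp 2 fun a => B a i, fun i j => ?_⟩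
  simp [PiLp.inner_apply, Matrix.mul_apply, Matrix.star_eq_conjTranspose, mul_comm]

/-- A real symmetric matrix has an eigenvalue below its quadratic form. -/
theorem Matrix.IsHermitian.exists_min_eigenvector {V : Type*} [Fintype V] [DecidableEq V]
    [Nonempty V] {M : Matrix V V ℝ} (hM : M.IsHermitian) :
    ∃ (l : ℝ) (v : V → ℝ), v ≠ 0 ∧ M.mulVec v = l • v ∧ (M - l • 1).PosSemidef := by
  obtain ⟨i, hi⟩ := Finite.exists_min hM.eigenvalues
  refine ⟨hM.eigenvalues i, hM.eigenvectorBasis i, ?_, hM.mulVec_eigenvectorBasis i, ?_⟩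
  · intro h
    refine hM.eigenvectorBasis.toBasis.ne_zero i ?_
    ext j
    simpa using congrFun h j
  · have hH : (M - hM.eigenvalues i • 1).IsHermitian := by
      refine hM.sub ?_
      simp [Matrix.IsHermitian]
    rw [hH.posSemidef_iff_eigenvalues_nonneg]
    intro j
    have h := hH.eigenvalues_mem_spectrum_real j
    have h2 : hH.eigenvalues j + hM.eigenvalues i ∈ spectrum ℝ M := by
      have := (spectrum.add_mem_add_iff (r := hH.eigenvalues j) (s := hM.eigenvalues i)
        (a := M - hM.eigenvalues i • 1)).mpr h
      rwa [Algebra.algebraMap_eq_smul_one, add_sub_cancel] at this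
    rw [hM.spectrum_real_eq_range_eigenvalues] at h2
    obtain ⟨k, hk⟩ := h2
    have := hi k
    simp only [Pi.zero_apply]
    linarith

/-- Two positive semidefinite real matrices have nonnegative entrywise inner product. -/
theorem Matrix.PosSemidef.sum_mul_nonneg {V : Type*} [Fintype V] {M N : Matrix V V ℝ}
    (hM : M.PosSemidef) (hN : N.PosSemidef) : 0 ≤ ∑ i, ∑ j, M i j * N i j := by
  obtain ⟨v, hv⟩ := hM.exists_gram
  -- A Gram matrix is a sum of rank-one matrices, one per coordinate `a` of the Gram vectors, so its
  -- pairing with `N` is a sum of values of the quadratic form of `N`.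
  have h : ∑ i, ∑ j, M i j * N i j =
      ∑ a, star (fun i => v i a) ⬝ᵥ (N.mulVec fun i => v i a) := by
    simp only [dotProduct, Matrix.mulVec, ← hv, PiLp.inner_apply, Finset.mul_sum, Finset.sum_mul]
    rw [Finset.sum_comm' (t' := Finset.univ) (s' := fun _ => Finset.univ) (by simp)]
    rw [Finset.sum_comm]
    refine (Finset.sum_congr rfl fun i _ => Finset.sum_comm).trans ?_
    rw [Finset.sum_comm]
    refine Finset.sum_congr rfl fun a _ => ?_
    refine Finset.sum_congr rfl fun i _ => Finset.sum_congr rfl fun j _ => ?_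
    simp
    ring
  rw [h]
  exact Finset.sum_nonneg fun a _ => hN.dotProduct_mulVec_nonneg _

/-! ### Bounds for the theta function and the Hoffman bound -/

namespace SimpleGraph

variable {V : Type*}

theorem lovaszTheta_bddBelow (G : SimpleGraph V) :
    BddBelow {t : ℝ | ∃ (m : ℕ) (u : V → EuclideanSpace ℝ (Fin m)) (c : EuclideanSpace ℝ (Fin m)),
    G.IsOrthonormalRep u ∧ ‖c‖ = 1 ∧ (∀ i, inner ℝ c (u i) ≠ 0) ∧
    t = ⨆ i, 1 / (inner ℝ c (u i)) ^ 2} := by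
  refine ⟨0, ?_⟩
  rintro t ⟨m, u, c, -, -, -, rfl⟩
  exact Real.iSup_nonneg fun i => by positivity

/-- An orthonormal representation in any finite-dimensional space, all of whose vectors have the
same inner product with a unit vector, bounds the theta function. -/
theorem mem_of_orthonormalRep [Nonempty V] (G : SimpleGraph V) {E : Type*}
    [NormedAddCommGroup E] [InnerProductSpace ℝ E] [FiniteDimensional ℝ E] (u : V → E) (c : E)
    (hu : ∀ i, ‖u i‖ = 1) (ho : ∀ i j, i ≠ j → ¬ G.Adj i j → inner ℝ (u i) (u j) = 0)
    (hc : ‖c‖ = 1) {s : ℝ} (hs : 0 < s) (h : ∀ i, inner ℝ c (u i) ^ 2 = 1 / s) :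
    s ∈ {t : ℝ | ∃ (m : ℕ) (u : V → EuclideanSpace ℝ (Fin m)) (c : EuclideanSpace ℝ (Fin m)),
    G.IsOrthonormalRep u ∧ ‖c‖ = 1 ∧ (∀ i, inner ℝ c (u i) ≠ 0) ∧
    t = ⨆ i, 1 / (inner ℝ c (u i)) ^ 2} := by
  let e := (stdOrthonormalBasis ℝ E).repr
  refine ⟨Module.finrank ℝ E, fun i => e (u i), e c, ⟨fun i => ?_, fun i j hij hG => ?_⟩, ?_, ?_, ?_⟩
  · rw [e.norm_map, hu]
  · rw [e.inner_map_map, ho i j hij hG]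
  · rw [e.norm_map, hc]
  · intro i h0
    have := h i
    rw [e.inner_map_map] at h0
    rw [h0] at this
    have : (0 : ℝ) < 1 / s := by positivity
    simp_all
  · simp [e.inner_map_map, h]

theorem lovaszTheta_le_of_orthonormalRep [Nonempty V] (G : SimpleGraph V) {E : Type*}
    [NormedAddCommGroup E] [InnerProductSpace ℝ E] [FiniteDimensional ℝ E] (u : V → E) (c : E)
    (hu : ∀ i, ‖u i‖ = 1) (ho : ∀ i j, i ≠ j → ¬ G.Adj i j → inner ℝ (u i) (u j) = 0)
    (hc : ‖c‖ = 1) {s : ℝ} (hs : 0 < s) (h : ∀ i, inner ℝ c (u i) ^ 2 = 1 / s) :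
    G.lovaszTheta ≤ s :=
  csInf_le G.lovaszTheta_bddBelow (G.mem_of_orthonormalRep u c hu ho hc hs h)

/-- To bound the theta function from below, it suffices to bound every orthonormal
representation. -/
theorem le_lovaszTheta [Fintype V] [Nonempty V] (G : SimpleGraph V) {b : ℝ}
    (h : ∀ (m : ℕ) (u : V → EuclideanSpace ℝ (Fin m)) (c : EuclideanSpace ℝ (Fin m)) (t : ℝ),
      G.IsOrthonormalRep u → ‖c‖ = 1 → (∀ i, inner ℝ c (u i) ≠ 0) →
      (∀ i, 1 / (inner ℝ c (u i)) ^ 2 ≤ t) → b ≤ t) : b ≤ G.lovaszTheta := by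
  classical
  refine le_csInf ⟨Fintype.card V, ?_⟩ ?_
  -- An infimum bound needs a nonempty set: an orthonormal basis with the normalised all-ones vector
  -- as `c` gives the value `n`.
  · have hn : (0 : ℝ) < Fintype.card V := by exact_mod_cast Fintype.card_pos
    refine G.mem_of_orthonormalRep (fun i => EuclideanSpace.single i (1 : ℝ))
      (WithLp.toLp 2 fun _ : V => 1 / √(Fintype.card V)) (by simp) ?_ ?_ hn ?_
    · intro i j hij _
      simp [EuclideanSpace.inner_single_left, hij]
    · rw [EuclideanSpace.norm_eq]
      simp [hn.ne']
    · intro i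
      simp [EuclideanSpace.inner_single_right]
  · rintro t ⟨m, u, c, hu, hc, h0, rfl⟩
    exact h m u c _ hu hc h0 fun i => 
      le_ciSup (f := fun i => 1 / inner ℝ c (u i) ^ 2) (Set.finite_range _).bddAbove i

theorem one_le_lovaszTheta [Fintype V] [Nonempty V] (G : SimpleGraph V) : 1 ≤ G.lovaszTheta := by
  refine G.le_lovaszTheta fun m u c t hu hc h0 ht => ?_
  obtain ⟨i⟩ := ‹Nonempty V›
  refine le_trans ?_ (ht i)
  have h1 : |inner ℝ c (u i)| ≤ 1 := by
    simpa [hc, hu.1 i] using abs_real_inner_le_norm c (u i)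
  have h2 : 0 < inner ℝ c (u i) ^ 2 := by have := h0 i; positivity
  rw [le_div_iff₀ h2, one_mul]
  exact (sq_le_one_iff_abs_le_one _).mpr h1

/-- The Hoffman bound for the complement, applied to an orthonormal representation. -/
theorem card_sub_le_mul_lovaszTheta_sub_one [Fintype V] [Nonempty V] [DecidableEq V]
    (G : SimpleGraph V) [DecidableRel G.Adj] {e : ℕ} (he : Gᶜ.IsRegularOfDegree e) {L : ℝ}
    (hL : (Gᶜ.adjMatrix ℝ + L • 1).PosSemidef) : (e : ℝ) ≤ L * (G.lovaszTheta - 1) := by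
  have hL0 : 0 ≤ L := by
    obtain ⟨i⟩ := ‹Nonempty V›
    simpa using hL.diag_nonneg (i := i)
  have key : ∀ (m : ℕ) (u : V → EuclideanSpace ℝ (Fin m)) (c : EuclideanSpace ℝ (Fin m)) (t : ℝ),
      G.IsOrthonormalRep u → ‖c‖ = 1 → (∀ i, inner ℝ c (u i) ≠ 0) →
      (∀ i, 1 / (inner ℝ c (u i)) ^ 2 ≤ t) → (e : ℝ) ≤ L * (t - 1) := by
    intro m u c t hu hc h0 ht
    -- Rescale `u i` to have component `c` along `c`, then drop that component. The Gram matrix of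
    -- `w` is `-1` at distinct non-adjacent pairs and at most `t - 1` on the diagonal, and its
    -- unknown entries sit at the edges of `G`, where `Gᶜ.adjMatrix + L • 1` vanishes.
    let w : V → EuclideanSpace ℝ (Fin m) := fun i => (inner ℝ c (u i))⁻¹ • u i - c
    have hw : ∀ i j, inner ℝ (w i) (w j) =
        (inner ℝ c (u i))⁻¹ * (inner ℝ c (u j))⁻¹ * inner ℝ (u i) (u j) - 1 := by
      intro i j
      have hi := h0 i
      have hj := h0 j
      have hcc : inner ℝ c c = 1 := by rw [real_inner_self_eq_norm_sq, hc]; norm_num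
      simp only [w, inner_sub_left, inner_sub_right, real_inner_smul_left, real_inner_smul_right,
        real_inner_comm c (u i), hcc]
      rw [inv_mul_cancel₀ hj, inv_mul_cancel₀ hi]
      ring
    have h := (Matrix.posSemidef_gram ℝ w).sum_mul_nonneg hL
    have hrow : ∀ i, ∑ j, Matrix.gram ℝ w i j * (Gᶜ.adjMatrix ℝ + L • 1) i j ≤
        L * (t - 1) - e := by
      intro i
      have h1 : ∀ j, Matrix.gram ℝ w i j * (Gᶜ.adjMatrix ℝ + L • 1) i j =
          (if i = j then L * (1 / inner ℝ c (u i) ^ 2 - 1) else 0) -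
            (if Gᶜ.Adj i j then 1 else 0) := by
        intro j
        rw [Matrix.gram_apply, hw]
        by_cases hij : i = j
        · subst hij
          rw [real_inner_self_eq_norm_sq, hu.1 i]
          simp
          ring
        · by_cases hG : G.Adj i j
          · simp [hij, hG]
          · simp [hij, hG, hu.2 i j hij hG]
      rw [Finset.sum_congr rfl fun j _ => h1 j, Finset.sum_sub_distrib, Finset.sum_ite_eq]
      rw [← degree_eq_sum_if_adj, he i]
      simp only [Finset.mem_univ, if_true]
      have := mul_le_mul_of_nonneg_left (ht i) hL0
      linarith
    have h2 := h.trans (Finset.sum_le_sum fun i _ => hrow i)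
    simp only [Finset.sum_const, nsmul_eq_mul] at h2
    have hn : (0 : ℝ) < (Finset.univ : Finset V).card := by
      exact_mod_cast Finset.card_pos.mpr Finset.univ_nonempty
    have := nonneg_of_mul_nonneg_right h2 hn
    linarith
  -- For `L = 0` division is impossible, but one representation suffices to get `e ≤ 0`. One exists,
  -- since otherwise `le_lovaszTheta` would hold vacuously for every `b`.
  rcases hL0.eq_or_lt with rfl | hLpos
  · obtain ⟨m, u, c, t, h1, h2, h3, h4⟩ : ∃ (m : ℕ) (u : V → EuclideanSpace ℝ (Fin m))
        (c : EuclideanSpace ℝ (Fin m)) (t : ℝ), G.IsOrthonormalRep u ∧ ‖c‖ = 1 ∧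
        (∀ i, inner ℝ c (u i) ≠ 0) ∧ ∀ i, 1 / (inner ℝ c (u i)) ^ 2 ≤ t := by
      by_contra hcon
      have := G.le_lovaszTheta (b := G.lovaszTheta + 1) fun m u c t h1 h2 h3 h4 =>
        (hcon ⟨m, u, c, t, h1, h2, h3, h4⟩).elim
      linarith
    have := key m u c t h1 h2 h3 h4
    linarith
  · have := G.le_lovaszTheta (b := e / L + 1) fun m u c t h1 h2 h3 h4 => by
      have := key m u c t h1 h2 h3 h4
      rw [← le_sub_iff_add_le, div_le_iff₀' hLpos]
      exact this
    rw [← le_sub_iff_add_le, div_le_iff₀' hLpos] at this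
    exact this

/-! ### Strong duality for the theta function -/

/-- Gram vectors have squared norm at most the trace, so Cauchy–Schwarz puts all entries in `[-1,
1]`. This is the compact side of the separation in `exists_dual_lovaszTheta`. -/
theorem isCompact_posSemidef_trace_one [Fintype V] :
    IsCompact {B : V → V → ℝ | (Matrix.of B).PosSemidef ∧ ∑ i, B i i = 1} := by
  refine (isCompact_Icc (a := fun _ _ : V => (-1 : ℝ)) (b := fun _ _ => 1)).of_isClosed_subset
    ?_ ?_
  · have : {B : V → V → ℝ | (Matrix.of B).PosSemidef} =
        {B | ∀ i j, B j i = B i j} ∩ {B | ∀ x : V → ℝ, 0 ≤ ∑ i, x i * ∑ j, B i j * x j} := by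
      ext B
      simp [Matrix.posSemidef_iff_dotProduct_mulVec, Matrix.IsHermitian, ← Matrix.ext_iff,
        dotProduct, Matrix.mulVec]
    rw [Set.ofPred_and, this]
    refine IsClosed.inter (IsClosed.inter ?_ ?_) (isClosed_eq (by fun_prop) (by fun_prop))
    · simp only [Set.ofPred_forall]
      exact isClosed_iInter fun i => isClosed_iInter fun j =>
        isClosed_eq (by fun_prop) (by fun_prop)
    · simp only [Set.ofPred_forall]
      exact isClosed_iInter fun x => isClosed_le (by fun_prop) (by fun_prop)
  · rintro B ⟨hB, htr⟩
    obtain ⟨v, hv⟩ := hB.exists_gram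
    have hd : ∀ i, ‖v i‖ ≤ 1 := fun i => by
      have h1 : B i i ≤ ∑ i, B i i :=
        Finset.single_le_sum (f := fun i => B i i) (fun i _ => hB.diag_nonneg) (Finset.mem_univ i)
      have h2 := hv i i
      rw [real_inner_self_eq_norm_sq] at h2
      simp only [Matrix.of_apply] at h2
      exact (sq_le_one_iff₀ (norm_nonneg _)).mp (by linarith)
    have habs : ∀ i j, |B i j| ≤ 1 := fun i j => by
      have h1 : inner ℝ (v i) (v j) = B i j := hv i j
      rw [← h1]
      exact (abs_real_inner_le_norm _ _).trans (mul_le_one₀ (hd i) (norm_nonneg _) (hd j))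
    exact ⟨fun i j => (abs_le.mp (habs i j)).1, fun i j => (abs_le.mp (habs i j)).2⟩

theorem convex_posSemidef_trace_one [Fintype V] :
    Convex ℝ {B : V → V → ℝ | (Matrix.of B).PosSemidef ∧ ∑ i, B i i = 1} := by
  rintro B ⟨hB, hB1⟩ C ⟨hC, hC1⟩ a b ha hb hab
  refine ⟨(hB.smul ha).add (hC.smul hb), ?_⟩
  simp [Finset.sum_add_distrib, ← Finset.mul_sum, hB1, hC1, hab]

/-- A symmetric matrix with ones on the diagonal and at the non-edges whose quadratic form is at
most `s` bounds the theta function by `s`. -/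
theorem lovaszTheta_le_of_posSemidef [Fintype V] [Nonempty V] (G : SimpleGraph V)
    {M : Matrix V V ℝ} {s : ℝ} (hs : 0 < s) (hM : M.PosSemidef) (hd : ∀ i, M i i = s - 1)
    (ho : ∀ i j, i ≠ j → ¬ G.Adj i j → M i j = -1) : G.lovaszTheta ≤ s := by
  obtain ⟨y, hy⟩ := hM.exists_gram
  have hs' : √s ^ 2 = s := Real.sq_sqrt hs.le
  have hpos : 0 < √s := Real.sqrt_pos.mpr hs
  -- The extra coordinate `1` cancels the Gram entry `-1` at non-edges and raises the squared norm
  -- from `s - 1` to `s`; the new axis serves as `c`.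
  refine G.lovaszTheta_le_of_orthonormalRep (E := WithLp 2 (EuclideanSpace ℝ V × ℝ))
    (fun i => (√s)⁻¹ • WithLp.toLp 2 (y i, (1 : ℝ))) (WithLp.toLp 2 (0, (1 : ℝ))) ?_ ?_ ?_ hs ?_
  · intro i
    rw [← sq_eq_sq₀ (norm_nonneg _) zero_le_one, ← real_inner_self_eq_norm_sq]
    rw [real_inner_smul_left, real_inner_smul_right, WithLp.prod_inner_apply]
    simp only [hy, hd]
    simp only [real_inner_self_eq_norm_sq, norm_one]
    field_simp
    linarith
  · intro i j hij hG
    rw [real_inner_smul_left, real_inner_smul_right, WithLp.prod_inner_apply]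
    simp only [hy, ho i j hij hG, real_inner_self_eq_norm_sq, norm_one]
    ring
  · rw [← sq_eq_sq₀ (norm_nonneg _) zero_le_one, ← real_inner_self_eq_norm_sq]
    simp
  · intro i
    simp [WithLp.prod_inner_apply, hs']

/-- Strong duality for the theta function: there is a dual feasible matrix whose value is at least
the theta function. -/
theorem exists_dual_lovaszTheta [Fintype V] [Nonempty V] (G : SimpleGraph V) :
    ∃ B : Matrix V V ℝ, B.PosSemidef ∧ ∑ i, B i i = 1 ∧ (∀ i j, G.Adj i j → B i j = 0) ∧
      G.lovaszTheta ≤ ∑ i, ∑ j, B i j := by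
  classical
  by_contra hcon
  obtain ⟨i₀⟩ := id ‹Nonempty V›
  set θ := G.lovaszTheta with hθ
  have hθ1 : 1 ≤ θ := G.one_le_lovaszTheta
  -- If no dual matrix exists, the closed convex set `T` misses the compact set of trace-one
  -- semidefinite matrices. The separating functional `f` will yield a representation of value below
  -- `θ`.
  let T : Set (V → V → ℝ) := {B | (∀ i j, G.Adj i j → B i j = 0) ∧ θ ≤ ∑ i, ∑ j, B i j}
  have hTconv : Convex ℝ T := by
    rintro B ⟨hB, hB1⟩ C ⟨hC, hC1⟩ a b ha hb hab
    refine ⟨fun i j h => by simp [hB i j h, hC i j h], ?_⟩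
    simp only [Pi.add_apply, Pi.smul_apply, smul_eq_mul, Finset.sum_add_distrib, ← Finset.mul_sum]
    calc θ = a * θ + b * θ := by rw [← add_mul, hab, one_mul]
      _ ≤ _ := add_le_add (mul_le_mul_of_nonneg_left hB1 ha) (mul_le_mul_of_nonneg_left hC1 hb)
  have hTclosed : IsClosed T := by
    simp only [T, Set.ofPred_and, Set.ofPred_forall]
    exact (isClosed_iInter fun i => isClosed_iInter fun j => isClosed_iInter fun _ =>
      isClosed_eq (by fun_prop) (by fun_prop)).inter (isClosed_le (by fun_prop) (by fun_prop))
  have hdisj : Disjoint {B : V → V → ℝ | (Matrix.of B).PosSemidef ∧ ∑ i, B i i = 1} T := by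
    rw [Set.disjoint_left]
    rintro B ⟨h1, h2⟩ ⟨h3, h4⟩
    exact hcon ⟨Matrix.of B, h1, h2, h3, h4⟩
  obtain ⟨f, u, v, hfS, huv, hfT⟩ := geometric_hahn_banach_compact_closed
    convex_posSemidef_trace_one isCompact_posSemidef_trace_one hTconv hTclosed hdisj
  let E : V → V → (V → V → ℝ) := fun i j => Pi.single i (Pi.single j 1)
  have hE : ∀ i j k l, E i j k l = if k = i ∧ l = j then 1 else 0 := by
    intro i j k l
    by_cases hk : k = i
    · subst hk; simp [E, Pi.single_apply]
    · simp [E, hk]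
  have hEsum : ∀ i j, ∑ k, ∑ l, E i j k l = 1 := by
    intro i j
    simp [hE, ite_and]
  have hf : ∀ B : V → V → ℝ, f B = ∑ i, ∑ j, B i j * f (E i j) := by
    intro B
    have : B = ∑ i, ∑ j, B i j • E i j := by
      ext k l
      simp [Finset.sum_apply, hE, ite_and]
    conv_lhs => rw [this]
    simp [map_sum]
  set κ := f (E i₀ i₀) with hκ
  -- For a non-edge (or `i = j`), `T` contains a whole line in the direction `E i j - E i₀ i₀`. As
  -- `f` is bounded below on `T`, it must be constant on the line; the parameter used below is the
  -- one where `f` would equal `v`.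
  have hFκ : ∀ i j, ¬ G.Adj i j → f (E i j) = κ := by
    intro i j hij
    by_contra hne
    have hmem : ∀ r : ℝ, θ • E i₀ i₀ + r • (E i j - E i₀ i₀) ∈ T := by
      refine fun r => ⟨fun k l hkl => ?_, ?_⟩
      · have h1 : ¬ (k = i ∧ l = j) := fun h => hij (h.1 ▸ h.2 ▸ hkl)
        have h2 : ¬ (k = i₀ ∧ l = i₀) := fun h => hkl.ne (h.1.trans h.2.symm)
        simp [hE, h1, h2]
      · simp [Finset.sum_add_distrib, Finset.sum_sub_distrib, ← Finset.mul_sum, hEsum]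
    have h := hfT _ (hmem ((v - θ * κ) / (f (E i j) - κ)))
    have hne' : f (E i j) - κ ≠ 0 := sub_ne_zero.mpr hne
    simp only [map_add, map_smul, map_sub, smul_eq_mul, ← hκ, div_mul_cancel₀ _ hne'] at h
    linarith
  have hκu : κ < u := by
    refine hfS _ ⟨?_, by simp [hE]⟩
    convert Matrix.posSemidef_vecMulVec_self_star (Pi.single i₀ (1 : ℝ)) using 1
    ext k l
    simp only [Matrix.of_apply, hE, Matrix.vecMulVec_apply, Pi.single_apply, star_trivial]
    by_cases hk : k = i₀ <;> by_cases hl : l = i₀ <;> simp [hk, hl]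
  have hvκ : v < θ * κ := by
    have hmem : θ • E i₀ i₀ ∈ T := by
      refine ⟨fun k l hkl => ?_, ?_⟩
      · have h2 : ¬ (k = i₀ ∧ l = i₀) := fun h => hkl.ne (h.1.trans h.2.symm)
        simp [hE, h2]
      · simp [← Finset.mul_sum, hEsum]
    simpa [← hκ] using hfT _ hmem
  -- Otherwise `θ * κ ≤ κ`, as `θ ≥ 1`, and then `v < θ * κ ≤ κ < u < v`.
  have hκpos : 0 < κ := by
    by_contra hneg
    nlinarith
  have hs : 0 < u / κ := div_pos (hκpos.trans hκu) hκpos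
  -- This is `(u / κ) • 1` minus the symmetrised coefficients of `f`, divided by `κ`. It is
  -- semidefinite because `f < u` on normalised rank-one matrices, and it is `-1` at non-edges, so
  -- `θ ≤ u / κ < v / κ < θ`, a contradiction.
  let M : Matrix V V ℝ := Matrix.of fun i j =>
    (if i = j then u / κ else 0) - (f (E i j) + f (E j i)) / (2 * κ)
  have hM : M.PosSemidef := by
    refine Matrix.PosSemidef.of_dotProduct_mulVec_nonneg ?_ fun x => ?_
    · ext i j
      simp [M, eq_comm, add_comm]
    · have hexp : star x ⬝ᵥ M.mulVec x =
          (u * ∑ i, x i ^ 2 - ∑ i, ∑ j, x i * x j * f (E i j)) / κ := by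
        have hsym : ∑ i, ∑ j, x i * x j * f (E j i) = ∑ i, ∑ j, x i * x j * f (E i j) := by
          rw [Finset.sum_comm]
          exact Finset.sum_congr rfl fun i _ => Finset.sum_congr rfl fun j _ => by ring
        have h1 : star x ⬝ᵥ M.mulVec x = ∑ i, (u / κ * x i ^ 2 -
            ∑ j, (x i * x j * f (E i j) + x i * x j * f (E j i)) / (2 * κ)) := by
          simp only [dotProduct, Matrix.mulVec, M, Matrix.of_apply, sub_mul, ite_mul, zero_mul,
            Finset.sum_sub_distrib, Finset.sum_ite_eq, Finset.mem_univ, if_true, mul_sub,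
            Finset.mul_sum, star_trivial]
          congr 1
          · exact Finset.sum_congr rfl fun i _ => by ring
          · exact Finset.sum_congr rfl fun i _ => Finset.sum_congr rfl fun j _ => by ring
        rw [h1, Finset.sum_sub_distrib]
        simp only [← Finset.sum_div, Finset.sum_add_distrib, hsym, ← Finset.mul_sum]
        field_simp
        ring
      rw [hexp]
      refine div_nonneg (sub_nonneg.mpr ?_) hκpos.le
      rcases eq_or_ne x 0 with rfl | hx
      · simp
      · have hq : 0 < ∑ i, x i ^ 2 := by
          obtain ⟨i, hi⟩ := Function.ne_iff.mp hx
          exact Finset.sum_pos' (fun i _ => sq_nonneg _) ⟨i, Finset.mem_univ i, by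
            have : x i ≠ 0 := hi
            positivity⟩
        have hmem : (fun i j => (∑ i, x i ^ 2)⁻¹ * (x i * x j)) ∈
            {B : V → V → ℝ | (Matrix.of B).PosSemidef ∧ ∑ i, B i i = 1} := by
          refine ⟨?_, ?_⟩
          · convert (Matrix.posSemidef_vecMulVec_self_star x).smul (inv_nonneg.mpr hq.le) using 1
            ext i j
            simp [Matrix.vecMulVec_apply]
          · simp only [← Finset.mul_sum, ← sq]
            exact inv_mul_cancel₀ hq.ne'
        have h := (hfS _ hmem).le
        rw [hf] at h
        simp only [mul_assoc, ← Finset.mul_sum] at h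
        rw [inv_mul_le_iff₀ hq] at h
        simpa only [mul_assoc, mul_comm u, Finset.mul_sum] using h
  have := G.lovaszTheta_le_of_posSemidef hs hM
    (fun i => by simp [M, hFκ i i (G.loopless.irrefl i)]; field_simp; ring)
    (fun i j hij hG => by
      simp [M, hij, hFκ i j hG, hFκ j i fun h => hG h.symm]; field_simp; ring)
  rw [← hθ, le_div_iff₀ hκpos] at this
  linarith

/-! ### The theta function of vertex-transitive and self-complementary graphs -/

/-- For vertex-transitive graphs a dual solution may be taken invariant under automorphisms. -/
theorem IsVertexTransitive.exists_dual_lovaszTheta [Fintype V] [Nonempty V] {G : SimpleGraph V}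
    (hG : G.IsVertexTransitive) :
    ∃ (C : Matrix V V ℝ) (r : ℝ), C.PosSemidef ∧ (∀ i, C i i = 1) ∧
      (∀ i j, G.Adj i j → C i j = 0) ∧ (∀ i, ∑ j, C i j = r) ∧ G.lovaszTheta ≤ r := by
  classical
  obtain ⟨B, hB, htr, hadj, hle⟩ := G.exists_dual_lovaszTheta
  have : Finite (G ≃g G) := Finite.of_injective (fun φ : G ≃g G => φ.toEquiv) fun φ ψ h => by
    ext i
    exact congrFun (congrArg DFunLike.coe h) i
  have := Fintype.ofFinite (G ≃g G)
  -- Summing over the automorphism group makes diagonal and row sums constant by transitivity. The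
  -- later factor `n / N` makes the diagonal `1` and the row sum equal to the sum of all entries of
  -- `B`.
  let B' : Matrix V V ℝ := ∑ φ : G ≃g G, B.submatrix φ φ
  have hB' : ∀ i j, B' i j = ∑ φ : G ≃g G, B (φ i) (φ j) := fun i j => by
    simp [B', Matrix.sum_apply]
  have hinv : ∀ (ψ : G ≃g G) i j, B' (ψ i) (ψ j) = B' i j := fun ψ i j => by
    rw [hB', hB']
    exact Fintype.sum_equiv (Equiv.mulRight ψ) _ _ fun φ => rfl
  have hpsd : B'.PosSemidef := Matrix.posSemidef_sum _ fun φ _ => hB.submatrix φ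
  obtain ⟨i₀⟩ := id ‹Nonempty V›
  have hn : (0 : ℝ) < Fintype.card V := by exact_mod_cast Fintype.card_pos
  have hN : (0 : ℝ) < Fintype.card (G ≃g G) := by
    exact_mod_cast Fintype.card_pos_iff.mpr ⟨Iso.refl⟩
  set n : ℝ := (Fintype.card V : ℝ)
  set N : ℝ := (Fintype.card (G ≃g G) : ℝ)
  have hdiag : ∀ i, B' i i = B' i₀ i₀ := fun i => by
    obtain ⟨ψ, rfl⟩ := hG i₀ i
    exact hinv ψ i₀ i₀
  have hrow : ∀ i, ∑ j, B' i j = ∑ j, B' i₀ j := fun i => by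
    obtain ⟨ψ, rfl⟩ := hG i₀ i
    rw [← Equiv.sum_comp ψ.toEquiv]
    exact Finset.sum_congr rfl fun j _ => hinv ψ i₀ j
  have htr' : ∑ i, B' i i = N := by
    simp only [hB']
    rw [Finset.sum_comm]
    have : ∀ φ : G ≃g G, ∑ i, B (φ i) (φ i) = 1 := fun φ =>
      (Equiv.sum_comp φ.toEquiv fun i => B i i).trans htr
    simp [this, N]
  have hsum' : ∑ i, ∑ j, B' i j = N * ∑ i, ∑ j, B i j := by
    simp only [hB']
    have : ∀ φ : G ≃g G, ∑ i, ∑ j, B (φ i) (φ j) = ∑ i, ∑ j, B i j := fun φ =>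
      (Finset.sum_congr rfl fun i _ => Equiv.sum_comp φ.toEquiv fun j => B (φ i) j).trans
        (Equiv.sum_comp φ.toEquiv fun i => ∑ j, B i j)
    rw [Finset.sum_congr rfl fun i _ => Finset.sum_comm, Finset.sum_comm]
    simp [this, N]
  have hd : n * B' i₀ i₀ = N := by
    rw [← htr', Finset.sum_congr rfl fun i _ => hdiag i]
    simp [n]
  have hr : n * ∑ j, B' i₀ j = N * ∑ i, ∑ j, B i j := by
    rw [← hsum', Finset.sum_congr rfl fun i _ => hrow i]
    simp [n]
  refine ⟨(n / N) • B', n / N * ∑ j, B' i₀ j, hpsd.smul (by positivity), fun i => ?_,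
    fun i j hij => ?_, fun i => ?_, ?_⟩
  · rw [Matrix.smul_apply, hdiag, smul_eq_mul, div_mul_eq_mul_div, hd, div_self hN.ne']
  · rw [Matrix.smul_apply, hB', Finset.sum_eq_zero, smul_zero]
    exact fun φ _ => hadj _ _ (φ.map_adj_iff.mpr hij)
  · simp only [Matrix.smul_apply, smul_eq_mul, ← Finset.mul_sum, hrow i]
  · rw [div_mul_eq_mul_div, hr, mul_div_cancel_left₀ _ hN.ne']
    exact hle

/-- `θ(G) θ(Gᶜ) ≤ n` for vertex-transitive graphs. -/
theorem IsVertexTransitive.lovaszTheta_compl_le [Fintype V] [Nonempty V] {G : SimpleGraph V}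
    (hG : G.IsVertexTransitive) : Gᶜ.lovaszTheta ≤ Fintype.card V / G.lovaszTheta := by
  obtain ⟨C, r, hC, hd, hadj, hrow, hle⟩ := hG.exists_dual_lovaszTheta
  obtain ⟨v, hv⟩ := hC.exists_gram
  have hθ : 0 < G.lovaszTheta := one_pos.trans_le G.one_le_lovaszTheta
  have hr : 0 < r := hθ.trans_le hle
  have hn : (0 : ℝ) < Fintype.card V := by exact_mod_cast Fintype.card_pos
  set n : ℝ := (Fintype.card V : ℝ)
  have hsv : ∀ i, inner ℝ (∑ j, v j) (v i) = r := fun i => by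
    rw [real_inner_comm, inner_sum, ← hrow i]
    exact Finset.sum_congr rfl fun j _ => hv i j
  have hss : inner ℝ (∑ j, v j) (∑ j, v j) = n * r := by
    rw [inner_sum, Finset.sum_congr rfl fun i _ => hsv i]
    simp [n]
  have hsq : √(n * r) ^ 2 = n * r := Real.sq_sqrt (by positivity)
  have hpos : 0 < √(n * r) := Real.sqrt_pos.mpr (by positivity)
  -- The entries of `C` vanish at the edges of `G`, so its Gram vectors represent `Gᶜ`. Their sum
  -- has squared norm `n * r` and inner product `r` with each of them, which gives the value `n /
  -- r`.
  refine (Gᶜ.lovaszTheta_le_of_orthonormalRep v ((√(n * r))⁻¹ • ∑ j, v j) (s := n / r) ?_ ?_ ?_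
    (by positivity) ?_).trans (by gcongr)
  · intro i
    rw [← sq_eq_sq₀ (norm_nonneg _) zero_le_one, ← real_inner_self_eq_norm_sq, hv, hd, one_pow]
  · intro i j hij hG
    rw [hv]
    refine hadj i j ?_
    by_contra h
    exact hG ((compl_adj _ _ _).mpr ⟨hij, h⟩)
  · rw [← sq_eq_sq₀ (norm_nonneg _) zero_le_one, ← real_inner_self_eq_norm_sq,
      real_inner_smul_left, real_inner_smul_right, hss]
    field_simp
    linarith
  · intro i
    rw [real_inner_smul_left, hsv, mul_pow, inv_pow, hsq]
    field_simp

theorem Iso.lovaszTheta_eq {W : Type*} {G : SimpleGraph V} {H : SimpleGraph W} (φ : G ≃g H) :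
    G.lovaszTheta = H.lovaszTheta := by
  unfold lovaszTheta
  congr 1
  ext t
  constructor
  · rintro ⟨m, u, c, ⟨h1, h2⟩, hc, h0, rfl⟩
    refine ⟨m, u ∘ φ.symm, c, ⟨fun i => h1 _, fun i j hij hH => h2 _ _ (by simpa using hij) ?_⟩,
      hc, fun i => h0 _, ?_⟩
    · rwa [φ.symm.map_adj_iff]
    · exact (φ.symm.toEquiv.iSup_comp (g := fun i => 1 / (inner ℝ c (u i)) ^ 2)).symm
  · rintro ⟨m, u, c, ⟨h1, h2⟩, hc, h0, rfl⟩
    refine ⟨m, u ∘ φ, c, ⟨fun i => h1 _, fun i j hij hH => h2 _ _ (by simpa using hij) ?_⟩,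
      hc, fun i => h0 _, ?_⟩
    · rwa [φ.map_adj_iff]
    · exact (φ.toEquiv.iSup_comp (g := fun i => 1 / (inner ℝ c (u i)) ^ 2)).symm

/-- The theta function of a self-complementary graph is at least `√n`. -/
theorem IsSelfComplementary.sqrt_card_le_lovaszTheta [Fintype V] [Nonempty V]
    {G : SimpleGraph V} (hG : G.IsSelfComplementary) : √(Fintype.card V) ≤ G.lovaszTheta := by
  obtain ⟨σ⟩ := hG
  refine G.le_lovaszTheta fun m u c t hu hc h0 ht => ?_
  let T : EuclideanSpace ℝ (Fin m) → EuclideanSpace ℝ (Fin m) →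
      EuclideanSpace ℝ (Fin m × Fin m) := fun x y => WithLp.toLp 2 fun p => x p.1 * y p.2
  have hT : ∀ x y x' y', inner ℝ (T x y) (T x' y') = inner ℝ x x' * inner ℝ y y' := by
    intro x y x' y'
    simp only [T, PiLp.inner_apply, Fintype.sum_prod_type, Finset.sum_mul_sum]
    refine Finset.sum_congr rfl fun a _ => Finset.sum_congr rfl fun b _ => ?_
    simp
    ring
  -- For `i ≠ j`, either `i` and `j` or their images under `σ` are non-adjacent in `G`, so one
  -- tensor factor vanishes. Bessel's inequality against `c ⊗ c` then gives `n / t ^ 2 ≤ 1`.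
  have hon : Orthonormal ℝ fun i => T (u i) (u (σ i)) := by
    refine ⟨fun i => ?_, fun i j hij => ?_⟩
    · rw [← sq_eq_sq₀ (norm_nonneg _) zero_le_one, ← real_inner_self_eq_norm_sq, hT,
        real_inner_self_eq_norm_sq, real_inner_self_eq_norm_sq, hu.1, hu.1]
      norm_num
    · refine (hT _ _ _ _).trans ?_
      by_cases h : G.Adj i j
      · rw [hu.2 (σ i) (σ j) (by simpa using hij), mul_zero]
        have := σ.map_adj_iff.mpr h
        exact ((compl_adj _ _ _).mp this).2
      · rw [hu.2 i j hij h, zero_mul]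
  have hbes := hon.sum_inner_products_le (T c c) (s := Finset.univ)
  have hcc : ‖T c c‖ ^ 2 = 1 := by
    rw [← real_inner_self_eq_norm_sq, hT, real_inner_self_eq_norm_sq, hc]
    norm_num
  have htpos : 0 < t := by
    obtain ⟨i⟩ := ‹Nonempty V›
    have := h0 i
    exact lt_of_lt_of_le (by positivity) (ht i)
  have hlow : ∀ i, 1 / t ≤ inner ℝ c (u i) ^ 2 := fun i => by
    have := h0 i
    exact (one_div_le (by positivity) htpos).mp (ht i)
  have hterm : ∀ i, 1 / t * (1 / t) ≤ ‖inner ℝ (T (u i) (u (σ i))) (T c c)‖ ^ 2 := fun i => by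
    rw [hT, real_inner_comm c (u i), real_inner_comm c (u (σ i)), Real.norm_eq_abs, sq_abs, mul_pow]
    exact mul_le_mul (hlow i) (hlow _) (by positivity) (sq_nonneg _)
  have h := (Finset.sum_le_sum fun i (_ : i ∈ Finset.univ) => hterm i).trans hbes
  rw [hcc] at h
  simp only [Finset.sum_const, nsmul_eq_mul, Finset.card_univ] at h
  refine Real.sqrt_le_iff.mpr ⟨htpos.le, ?_⟩
  field_simp at h
  exact h

/-- The theta function of a self-complementary vertex-transitive graph is `√n`. -/
theorem IsSelfComplementary.lovaszTheta_eq [Fintype V] [Nonempty V] {G : SimpleGraph V}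
    (hG : G.IsSelfComplementary) (hvt : G.IsVertexTransitive) :
    G.lovaszTheta = √(Fintype.card V) := by
  refine le_antisymm ?_ hG.sqrt_card_le_lovaszTheta
  obtain ⟨σ⟩ := hG
  have h := hvt.lovaszTheta_compl_le
  rw [← σ.lovaszTheta_eq, le_div_iff₀ (one_pos.trans_le G.one_le_lovaszTheta)] at h
  exact Real.le_sqrt_of_sq_le (by rwa [sq])

/-! ### Connectedness, valency and eigenvectors of strong powers -/

theorem strongPower_adj (G : SimpleGraph V) (k : ℕ) (x y : Fin k → V) :
    (G.strongPower k).Adj x y ↔ x ≠ y ∧ ∀ i, x i = y i ∨ G.Adj (x i) (y i) :=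
  Iff.rfl

/-- Coordinates can be changed one at a time, each along a walk in `G`; the other coordinates may
stay fixed. -/
theorem Connected.strongPower {G : SimpleGraph V} (hG : G.Connected) (k : ℕ) :
    (G.strongPower k).Connected := by
  classical
  have : Nonempty V := hG.nonempty
  have hupd : ∀ (x : Fin k → V) (i : Fin k) (w : V),
      (G.strongPower k).Reachable x (Function.update x i w) := by
    intro x i w
    have hxw : G.Reachable (x i) w := hG.preconnected _ _
    rw [reachable_iff_reflTransGen] at hxw
    induction hxw with
    | refl => simp
    | @tail b c _ hbc ih =>
      refine ih.trans (Adj.reachable ⟨fun h => hbc.ne ?_, fun j => ?_⟩)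
      · simpa using congrFun h i
      · rcases eq_or_ne j i with rfl | hj
        · exact Or.inr (by simpa using hbc)
        · exact Or.inl (by simp [hj])
  refine ⟨fun x y => ?_⟩
  have h : ∀ s : Finset (Fin k), (G.strongPower k).Reachable x (s.piecewise y x) := by
    intro s
    induction s using Finset.induction_on with
    | empty => simp
    | insert j s _ ih =>
      rw [Finset.piecewise_insert]
      exact ih.trans (hupd _ _ _)
  simpa using h Finset.univ

/-- Summation over the neighbours in a strong power. -/
theorem sum_strongPower_adj [Fintype V] [DecidableEq V] (G : SimpleGraph V) [DecidableRel G.Adj]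
    (k : ℕ) [DecidableRel (G.strongPower k).Adj] (f : (Fin k → V) → ℝ) (x : Fin k → V) :
    ∑ y ∈ (G.strongPower k).neighborFinset x, f y =
      ∑ y ∈ Fintype.piFinset fun i => insert (x i) (G.neighborFinset (x i)), f y - f x := by
  -- The closed neighbourhood of a tuple is the product of the closed neighbourhoods of its entries.
  have h : (G.strongPower k).neighborFinset x =
      (Fintype.piFinset fun i => insert (x i) (G.neighborFinset (x i))).erase x := by
    ext y
    simp [strongPower_adj, eq_comm]
  rw [h, eq_sub_iff_add_eq]
  exact Finset.sum_erase_add _ _ (by simp)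

theorem IsRegularOfDegree.strongPower [Fintype V] {G : SimpleGraph V} [DecidableRel G.Adj] {d : ℕ}
    (hG : G.IsRegularOfDegree d) (k : ℕ) [DecidableRel (G.strongPower k).Adj] :
    (G.strongPower k).IsRegularOfDegree ((d + 1) ^ k - 1) := by
  classical
  intro x
  have h := G.sum_strongPower_adj k (fun _ => 1) x
  simp only [Finset.sum_const, card_neighborFinset_eq_degree, Fintype.card_piFinset, nsmul_eq_mul,
    mul_one] at h
  have hi : ∀ i, (insert (x i) (G.neighborFinset (x i))).card = d + 1 := fun i => by
    rw [Finset.card_insert_of_notMem (by simp), card_neighborFinset_eq_degree, hG]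
  simp only [hi, Finset.prod_const, Finset.card_univ, Fintype.card_fin] at h
  have hpos : 1 ≤ (d + 1) ^ k := Nat.one_le_pow _ _ (by omega)
  have : ((G.strongPower k).degree x : ℝ) = ((d + 1) ^ k - 1 : ℕ) := by
    rw [h]
    push_cast [Nat.cast_sub hpos]
    ring
  exact_mod_cast this

/-- An eigenvector of `G` lifts to strong powers through the first coordinate. -/
theorem sum_strongPower_eigenvector [Fintype V] {G : SimpleGraph V} [DecidableRel G.Adj] {d : ℕ}
    (hG : G.IsRegularOfDegree d) {v : V → ℝ} {L : ℝ}
    (hv : ∀ i, v i + ∑ j ∈ G.neighborFinset i, v j = L * v i) (m : ℕ)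
    [DecidableRel (G.strongPower (m + 1)).Adj] (x : Fin (m + 1) → V) :
    ∑ y ∈ (G.strongPower (m + 1)).neighborFinset x, v (y 0) =
      (L * ((d : ℝ) + 1) ^ m - 1) * v (x 0) := by
  classical
  rw [G.sum_strongPower_adj (m + 1) (fun y => v (y 0)) x]
  -- The sum over the product of closed neighbourhoods factorises: coordinate `0` contributes `L * v
  -- (x 0)`, each of the others `d + 1`.
  have h := Finset.prod_univ_sum (fun i => insert (x i) (G.neighborFinset (x i)))
    (fun (i : Fin (m + 1)) (j : V) => if i = 0 then v j else 1)
  have hi : ∀ i, ((insert (x i) (G.neighborFinset (x i))).card : ℝ) = d + 1 := fun i => by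
    rw [Finset.card_insert_of_notMem (by simp), card_neighborFinset_eq_degree, hG]
    push_cast
    rfl
  simp only [Fin.prod_univ_succ, Fin.succ_ne_zero, if_true, if_false, Finset.prod_const_one,
    mul_one, Finset.sum_const, nsmul_eq_mul, hi] at h
  rw [← h, Finset.sum_insert (by simp), hv]
  simp
  ring

/-- Nontrivial eigenvalues are bounded by `lambdaNontrivial`. -/
theorem abs_le_lambdaNontrivial [Fintype V] {G : SimpleGraph V} [DecidableRel G.Adj] {d : ℕ}
    {f : V → ℝ} (hf : f ≠ 0) {μ : ℝ} (h : ∀ i, ∑ j ∈ G.neighborFinset i, f j = μ * f i)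
    (h1 : μ ≠ d) (h2 : μ ≠ -d) : |μ| ≤ G.lambdaNontrivial d := by
  classical
  have hfin := Matrix.finite_real_spectrum (A := G.adjMatrix ℝ)
  refine le_csSup ?_ ?_
  · refine ((hfin.image fun x => |x|).subset ?_).bddAbove
    rintro _ ⟨ν, hν, -, -, rfl⟩
    refine ⟨ν, ?_, rfl⟩
    convert hν
  · refine ⟨μ, ?_, h1, h2, rfl⟩
    have : μ ∈ spectrum ℝ (G.adjMatrix ℝ) := by
      rw [← Matrix.spectrum_toLin']
      refine (Module.End.hasEigenvalue_of_hasEigenvector (x := f) ⟨?_, hf⟩).mem_spectrum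
      rw [Module.End.mem_eigenspace_iff]
      ext i
      simp [adjMatrix_mulVec_apply, h]
    convert this

/-- An eigenvector of a connected regular graph for the valency is constant. -/
theorem eq_of_sum_neighborFinset_eq [Fintype V] {G : SimpleGraph V} [DecidableRel G.Adj] {d : ℕ}
    (hc : G.Connected) (hG : G.IsRegularOfDegree d) {v : V → ℝ}
    (hv : ∀ i, ∑ j ∈ G.neighborFinset i, v j = d * v i) (i j : V) : v i = v j := by
  classical
  refine G.lapMatrix_mulVec_eq_zero_iff_forall_reachable.mp ?_ i j (hc.preconnected i j)
  ext i
  rw [lapMatrix_mulVec_apply, hv, hG i]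
  simp

/-! ### A large nontrivial eigenvalue from the theta function -/

/-- A connected regular non-complete graph has a nontrivial eigenvalue `L - 1` that is large in
terms of the theta function. -/
theorem exists_eigenvector_lovaszTheta [Fintype V] {G : SimpleGraph V} [DecidableRel G.Adj]
    {d : ℕ} (hc : G.Connected) (hG : G.IsRegularOfDegree d) (hd : d + 1 < Fintype.card V) :
    ∃ (L : ℝ) (v : V → ℝ), v ≠ 0 ∧ (∀ i, v i + ∑ j ∈ G.neighborFinset i, v j = L * v i) ∧
      0 < L ∧ L < (d : ℝ) + 1 ∧
      (Fintype.card V : ℝ) - (d + 1) ≤ L * (G.lovaszTheta - 1) := by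
  classical
  have : Nonempty V := hc.nonempty
  obtain ⟨l, v, hv0, hv, hpsd⟩ := (Gᶜ.isHermitian_adjMatrix (R := ℝ)).exists_min_eigenvector
  have hGc := hG.compl
  have hcast : ((Fintype.card V - 1 - d : ℕ) : ℝ) = Fintype.card V - (d + 1) := by
    rw [Nat.sub_sub, Nat.cast_sub (by omega)]
    push_cast
    ring
  have hθ := G.card_sub_le_mul_lovaszTheta_sub_one hGc (L := -l) (by
    simpa [sub_eq_add_neg] using hpsd)
  rw [hcast] at hθ
  have hpos : (0 : ℝ) < Fintype.card V - (d + 1) := by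
    have : ((d + 1 : ℕ) : ℝ) < Fintype.card V := by exact_mod_cast hd
    push_cast at this
    linarith
  have hθ1 := G.one_le_lovaszTheta
  have hL : 0 < -l := by
    by_contra hneg
    nlinarith
  have hcompl : ∀ i, ∑ j ∈ Gᶜ.neighborFinset i, v j = l * v i := fun i => by
    have := congrFun hv i
    rwa [adjMatrix_mulVec_apply] at this
  have hsplit : ∀ i, v i + ∑ j ∈ G.neighborFinset i, v j + ∑ j ∈ Gᶜ.neighborFinset i, v j =
      ∑ j, v j := fun i => by
    rw [← Finset.sum_insert (by simp), neighborFinset_compl, ← Finset.sum_add_sum_compl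
      (insert i (G.neighborFinset i))]
    congr 2
    ext j
    simp [and_comm]
  -- Summing the eigenvalue equation over all vertices gives `(n - (d + 1) - l) * ∑ i, v i = 0`, and
  -- the first factor is positive since `l < 0`.
  have hsum : ∑ i, v i = 0 := by
    have h1 : ∑ i, ∑ j ∈ Gᶜ.neighborFinset i, v j =
        ((Fintype.card V : ℝ) - (d + 1)) * ∑ i, v i := by
      have : ∑ i, ∑ j ∈ Gᶜ.neighborFinset i, v j = ∑ j, ∑ i ∈ Gᶜ.neighborFinset j, v j :=
        Finset.sum_comm' (by simp [G.adj_comm, eq_comm])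
      rw [this]
      simp only [Finset.sum_const, card_neighborFinset_eq_degree, hGc.degree_eq, nsmul_eq_mul,
        hcast, Finset.mul_sum]
    simp only [hcompl, ← Finset.mul_sum] at h1
    have h2 : ((Fintype.card V : ℝ) - (d + 1) - l) * ∑ i, v i = 0 := by linarith
    exact (mul_eq_zero.mp h2).resolve_left (by linarith)
  have heig : ∀ i, v i + ∑ j ∈ G.neighborFinset i, v j = -l * v i := fun i => by
    have h1 := hsplit i
    rw [hsum, hcompl] at h1
    linarith
  refine ⟨-l, v, hv0, heig, hL, ?_, hθ⟩
  have hle : -l ≤ d + 1 := by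
    obtain ⟨i, hi⟩ := Finite.exists_max fun i => |v i|
    have hvi : 0 < |v i| := by
      obtain ⟨j, hj⟩ := Function.ne_iff.mp hv0
      exact lt_of_lt_of_le (abs_pos.mpr hj) (hi j)
    have h1 : |∑ j ∈ G.neighborFinset i, v j| ≤ d * |v i| := by
      refine (Finset.abs_sum_le_sum_abs _ _).trans ?_
      refine (Finset.sum_le_sum fun j _ => hi j).trans ?_
      simp [hG.degree_eq]
    have h2 : |-l * v i| ≤ |v i| + d * |v i| := by
      rw [← heig]
      exact (abs_add_le _ _).trans (by linarith)
    rw [abs_mul, abs_of_pos hL] at h2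
    exact le_of_mul_le_mul_right (by linarith) hvi
  -- If `L = d + 1`, then `v` is constant by connectedness, and its sum being zero makes it vanish.
  refine lt_of_le_of_ne hle fun h => hv0 ?_
  have hconst := eq_of_sum_neighborFinset_eq hc hG (v := v) fun i => by
    have := heig i
    rw [h] at this
    linarith
  ext i
  have : ∑ j, v j = Fintype.card V * v i := by
    rw [Finset.sum_congr rfl fun j _ => hconst j i]
    simp
  rw [hsum] at this
  have hn : (Fintype.card V : ℝ) ≠ 0 := by positivity
  exact (mul_eq_zero.mp this.symm).resolve_left hn

/-! ### The numerical comparison and the threshold -/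

/-- This has the shape of the Hoffman bound for a strong power, with `L * D ^ m` and `θ ^ (m + 1)`
in place of `L` and `θ`. It follows by telescoping from the case `m = 0`, using `n ≤ D * θ`, so
multiplicativity of `θ` is not needed. -/
theorem pow_sub_pow_le_mul_pow {n D θ L : ℝ} (hD : 0 < D) (hDn : D < n) (hθ : 1 ≤ θ)
    (hL : 0 < L) (hLD : L < D) (h : n - D ≤ L * (θ - 1)) (m : ℕ) :
    n ^ (m + 1) - D ^ (m + 1) ≤ L * D ^ m * (θ ^ (m + 1) - 1) := by
  have hn : n ≤ D * θ := by nlinarith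
  induction m with
  | zero => simpa using h
  | succ m ih =>
    have h1 : n ^ (m + 1) ≤ D ^ (m + 1) * θ ^ (m + 1) := by
      rw [← mul_pow]
      exact pow_le_pow_left₀ (by linarith) hn _
    have h2 : n ^ (m + 1) * (n - D) ≤ D ^ (m + 1) * θ ^ (m + 1) * (L * (θ - 1)) :=
      mul_le_mul h1 h (by linarith) (by positivity)
    have h3 := mul_le_mul_of_nonneg_left ih hD.le
    calc n ^ (m + 1 + 1) - D ^ (m + 1 + 1)
        = D * (n ^ (m + 1) - D ^ (m + 1)) + n ^ (m + 1) * (n - D) := by ring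
      _ ≤ D * (L * D ^ m * (θ ^ (m + 1) - 1)) + D ^ (m + 1) * θ ^ (m + 1) * (L * (θ - 1)) :=
          add_le_add h3 h2
      _ = L * D ^ (m + 1) * (θ ^ (m + 1 + 1) - 1) := by ring

theorem two_mul_sqrt_pow_lt {n D θ L : ℝ} (hD : 1 ≤ D) (hDn : D < n) (hθ : 1 ≤ θ)
    (hL : 0 < L) (hLD : L < D) (h : n - D ≤ L * (θ - 1)) {m : ℕ} (hm : 2 ≤ m)
    (hk : (2 + (√D ^ 3)⁻¹) * (n ^ 3 / (n ^ 3 - D ^ 3)) ≤ (n / (θ * √D)) ^ (m + 1)) :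
    2 * √D ^ (m + 1) < L * D ^ m - 1 := by
  have hD0 : 0 < D := by linarith
  have hn : 0 < n := by linarith
  have hθ0 : 0 < θ := by linarith
  have ha : 1 ≤ √D := Real.one_le_sqrt.mpr hD
  have ha0 : 0 < √D := by linarith
  have h3 : 0 < n ^ 3 - D ^ 3 := sub_pos.mpr (pow_lt_pow_left₀ hDn hD0.le (by norm_num))
  have hgeo := pow_sub_pow_le_mul_pow hD0 hDn hθ hL hLD h m
  have hstrict : n ^ (m + 1) - D ^ (m + 1) < L * D ^ m * θ ^ (m + 1) := by
    have : 0 < L * D ^ m := by positivity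
    linarith
  -- Since `m + 1 ≥ 3` and `D < n`, the fraction `(D / n) ^ (m + 1)` is at most `(D / n) ^ 3`.
  have hratio : n ^ (m + 1) * ((n ^ 3 - D ^ 3) / n ^ 3) ≤ n ^ (m + 1) - D ^ (m + 1) := by
    obtain ⟨j, rfl⟩ := Nat.exists_eq_add_of_le hm
    have : n ^ (2 + j + 1) * ((n ^ 3 - D ^ 3) / n ^ 3) = n ^ (2 + j + 1) - D ^ 3 * n ^ j := by
      field_simp
      ring
    rw [this]
    have h1 : D ^ 3 * D ^ j ≤ D ^ 3 * n ^ j :=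
      mul_le_mul_of_nonneg_left (pow_le_pow_left₀ hD0.le hDn.le _) (by positivity)
    calc n ^ (2 + j + 1) - D ^ 3 * n ^ j ≤ n ^ (2 + j + 1) - D ^ 3 * D ^ j := by linarith
      _ = _ := by ring
  have hmain : (2 + (√D ^ 3)⁻¹) * (θ * √D) ^ (m + 1) ≤
      n ^ (m + 1) * ((n ^ 3 - D ^ 3) / n ^ 3) := by
    rw [div_pow, le_div_iff₀ (by positivity)] at hk
    have h1 : 0 ≤ (n ^ 3 - D ^ 3) / n ^ 3 := by positivity
    calc (2 + (√D ^ 3)⁻¹) * (θ * √D) ^ (m + 1)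
        = (2 + (√D ^ 3)⁻¹) * (n ^ 3 / (n ^ 3 - D ^ 3)) * (θ * √D) ^ (m + 1) *
          ((n ^ 3 - D ^ 3) / n ^ 3) := by field_simp
      _ ≤ _ := mul_le_mul_of_nonneg_right hk h1
  have hlt : (2 + (√D ^ 3)⁻¹) * √D ^ (m + 1) < L * D ^ m := by
    rw [mul_pow] at hmain
    have h1 : (2 + (√D ^ 3)⁻¹) * √D ^ (m + 1) * θ ^ (m + 1) < L * D ^ m * θ ^ (m + 1) := by
      linarith
    exact lt_of_mul_lt_mul_right h1 (by positivity)
  -- The term `D ^ (-3 / 2)` of the threshold absorbs the `-1` in the eigenvalue; this again uses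
  -- exponent at least `3`.
  have hone : 1 ≤ (√D ^ 3)⁻¹ * √D ^ (m + 1) := by
    rw [inv_mul_eq_div, one_le_div (by positivity)]
    exact pow_le_pow_right₀ ha (by omega)
  linarith

theorem rpow_neg_three_halves {D : ℝ} (hD : 0 ≤ D) : D ^ (-(3 / 2) : ℝ) = (√D ^ 3)⁻¹ := by
  rw [Real.rpow_neg hD, Real.sqrt_eq_rpow, ← Real.rpow_natCast, ← Real.rpow_mul hD]
  norm_num

theorem one_lt_div_mul_sqrt {n D θ : ℝ} (hD : 0 < D) (hθ : 0 < θ) (h : θ < n / √D) :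
    1 < n / (θ * √D) := by
  rw [one_lt_div (by positivity)]
  rwa [lt_div_iff₀ (by positivity)] at h

/-- The threshold is the least `k ≥ 3` that satisfies an explicit inequality. -/
theorem ramanujanThreshold_le_iff {n d : ℕ} {θ : ℝ} (hdn : d + 1 < n) (hθ : 0 < θ)
    (h : θ < n / √((d : ℝ) + 1)) {k : ℕ} :
    ramanujanThreshold n d θ ≤ k ↔ 3 ≤ k ∧
      (2 + (√((d : ℝ) + 1) ^ 3)⁻¹) * ((n : ℝ) ^ 3 / ((n : ℝ) ^ 3 - ((d : ℝ) + 1) ^ 3)) ≤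
        ((n : ℝ) / (θ * √((d : ℝ) + 1))) ^ k := by
  have hD : (0 : ℝ) < (d : ℝ) + 1 := by positivity
  have hDn : (d : ℝ) + 1 < n := by exact_mod_cast hdn
  have h3 : 0 < (n : ℝ) ^ 3 - ((d : ℝ) + 1) ^ 3 :=
    sub_pos.mpr (pow_lt_pow_left₀ hDn hD.le (by norm_num))
  have hn : (0 : ℝ) < n := hD.trans hDn
  have hr := one_lt_div_mul_sqrt hD hθ h
  rw [ramanujanThreshold, max_le_iff, Nat.ceil_le, div_le_iff₀ (Real.log_pos hr),
    rpow_neg_three_halves hD.le, ← Real.log_mul (by positivity) (by positivity), ← Real.log_pow,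
    Real.log_le_log_iff (by positivity) (by positivity)]

/-! ### Strong powers are highly non-Ramanujan -/

theorem stronglyNonRamanujan_of_lovaszTheta_lt {V : Type*} [Fintype V] {G : SimpleGraph V}
    [DecidableRel G.Adj] {d : ℕ} (hc : G.Connected) (hG : G.IsRegularOfDegree d)
    (hbot : G ≠ ⊥) (htop : G ≠ ⊤)
    (hθ : G.lovaszTheta < (Fintype.card V : ℝ) / √((d : ℝ) + 1)) :
    G.StrongPowersHighlyNonRamanujan d
      (ramanujanThreshold (Fintype.card V) d G.lovaszTheta) := by
  classical
  have : Nonempty V := hc.nonempty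
  have hd : 1 ≤ d := by
    by_contra hd0
    refine hbot (eq_bot_iff.mpr fun i j hij => ?_)
    have := hij.degree_pos_left
    rw [hG] at this
    omega
  have hdn : d + 1 < Fintype.card V := by
    by_contra hcon
    refine htop (eq_top_iff.mpr fun i j hij => ?_)
    have h1 : (insert i (G.neighborFinset i)) = Finset.univ := by
      rw [← Finset.card_eq_iff_eq_univ]
      refine le_antisymm (Finset.card_le_univ _) ?_
      rw [Finset.card_insert_of_notMem (by simp), card_neighborFinset_eq_degree, hG]
      omega
    have h2 : j ∈ insert i (G.neighborFinset i) := h1 ▸ Finset.mem_univ j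
    simpa [Ne.symm hij] using h2
  obtain ⟨L, v, hv0, hv, hL, hLD, hbound⟩ := exists_eigenvector_lovaszTheta hc hG hdn
  have hθ1 := G.one_le_lovaszTheta
  set k₀ := ramanujanThreshold (Fintype.card V) d G.lovaszTheta with hk₀
  have hk3 : 3 ≤ k₀ := le_max_left _ _
  obtain ⟨m, hm⟩ : ∃ m, k₀ = m + 1 := ⟨k₀ - 1, by omega⟩
  set D : ℝ := (d : ℝ) + 1 with hDdef
  have hD2 : 2 ≤ D := by
    have : (1 : ℝ) ≤ d := by exact_mod_cast hd
    linarith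
  have hDn : D < Fintype.card V := by
    rw [hDdef]
    exact_mod_cast hdn
  have hmain : 2 * √D ^ (m + 1) < L * D ^ m - 1 :=
    two_mul_sqrt_pow_lt (by linarith) hDn hθ1 hL hLD hbound (by omega)
      ((ramanujanThreshold_le_iff hdn (by linarith) hθ).mp hm.le).2
  have ha : 1 < √D := by
    rw [Real.lt_sqrt zero_le_one]
    linarith
  have ha2 : √D * √D = D := Real.mul_self_sqrt (by linarith)
  set a := √D with hadef
  have ha0 : 0 < a := by linarith
  -- The lifted eigenvalue is nontrivial: `L < D` keeps it below the valency, and positivity keeps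
  -- it away from minus the valency.
  have hlam : ∀ j, L * D ^ (m + j) - 1 ≤
      (G.strongPower (m + 1 + j)).lambdaNontrivial ((d + 1) ^ (m + 1 + j) - 1) := by
    intro j
    have hcast : (((d + 1) ^ (m + j + 1) - 1 : ℕ) : ℝ) = D ^ (m + j + 1) - 1 := by
      rw [Nat.cast_sub (Nat.one_le_pow _ _ (by omega))]
      push_cast
      rfl
    have hpos : 0 < L * D ^ (m + j) - 1 := by
      have h1 : L * D ^ m ≤ L * D ^ (m + j) :=
        mul_le_mul_of_nonneg_left (pow_le_pow_right₀ (by linarith) (by omega)) hL.le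
      have : 0 < a ^ (m + 1) := by positivity
      linarith
    rw [show m + 1 + j = m + j + 1 by ring]
    refine (le_abs_self _).trans (abs_le_lambdaNontrivial (f := fun x => v (x 0)) ?_
      (sum_strongPower_eigenvector hG hv (m + j)) ?_ ?_)
    · intro h0
      refine hv0 (funext fun i => ?_)
      exact congrFun h0 fun _ => i
    · rw [hcast]
      have : L * D ^ (m + j) < D * D ^ (m + j) := mul_lt_mul_of_pos_right hLD (by positivity)
      refine ne_of_lt ?_
      rw [pow_succ']
      linarith
    · rw [hcast]
      have : 1 ≤ D ^ (m + j + 1) := one_le_pow₀ (by linarith)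
      refine ne_of_gt (lt_of_le_of_lt ?_ hpos)
      linarith
  -- The `k₀`-th root of the ratio `q` of eigenvalue to bound at `k₀` handles `k = k₀`. Capping `ρ`
  -- at `√D` carries the estimate to larger `k`: each further factor multiplies the bound by `√D`
  -- and the main term of the eigenvalue by `D = √D * √D`.
  obtain ⟨ρ, hρ1, hρa, hρ⟩ : ∃ ρ : ℝ, 1 < ρ ∧ ρ ≤ a ∧
      ρ ^ (m + 1) * (2 * a ^ (m + 1)) ≤ L * D ^ m - 1 := by
    set q := (L * D ^ m - 1) / (2 * a ^ (m + 1)) with hq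
    have hq1 : 1 < q := by rwa [hq, one_lt_div (by positivity)]
    refine ⟨min a (q ^ (((m + 1 : ℕ) : ℝ)⁻¹)), ?_, min_le_left _ _, ?_⟩
    · exact lt_min ha (Real.one_lt_rpow hq1 (by positivity))
    · rw [← le_div_iff₀ (by positivity), ← hq]
      calc _ ≤ (q ^ (((m + 1 : ℕ) : ℝ)⁻¹)) ^ (m + 1) :=
            pow_le_pow_left₀ (le_min ha0.le (by positivity)) (min_le_right _ _) _
        _ = q := Real.rpow_inv_natCast_pow (by linarith) (by omega)
  have hfinal : ∀ k, k₀ ≤ k → ρ ^ k * (2 * √(D ^ k - 1 - 1)) ≤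
      (G.strongPower k).lambdaNontrivial ((d + 1) ^ k - 1) := by
    intro k hk
    obtain ⟨j, rfl⟩ := Nat.exists_eq_add_of_le hk
    rw [hm]
    refine le_trans ?_ (hlam j)
    have h1 : √(D ^ (m + 1 + j) - 1 - 1) ≤ a ^ (m + 1 + j) := by
      refine Real.sqrt_le_iff.mpr ⟨by positivity, ?_⟩
      rw [← pow_mul, mul_comm _ 2, pow_mul, sq, ha2]
      linarith
    have hDj : 1 ≤ D ^ j := one_le_pow₀ (by linarith)
    have hρj : ρ ^ j ≤ a ^ j := pow_le_pow_left₀ (by linarith) hρa j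
    calc ρ ^ (m + 1 + j) * (2 * √(D ^ (m + 1 + j) - 1 - 1))
        ≤ ρ ^ (m + 1 + j) * (2 * a ^ (m + 1 + j)) := by gcongr
      _ = ρ ^ j * a ^ j * (ρ ^ (m + 1) * (2 * a ^ (m + 1))) := by ring
      _ ≤ a ^ j * a ^ j * (L * D ^ m - 1) :=
          mul_le_mul (by gcongr) hρ (by positivity) (by positivity)
      _ = L * D ^ (m + j) - D ^ j := by rw [← mul_pow, ha2]; ring
      _ ≤ L * D ^ (m + j) - 1 := by linarith
  refine ⟨fun k hk => ⟨hc.strongPower k, ?_, ?_⟩, ρ, hρ1, hfinal⟩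
  · exact hG.strongPower k
  · rintro ⟨d', hd', -, hreg, hle⟩
    have hreg' : (G.strongPower k).IsRegularOfDegree ((d + 1) ^ k - 1) := hG.strongPower k
    obtain ⟨i⟩ := ‹Nonempty V›
    have hdd : d' = (d + 1) ^ k - 1 := by
      rw [← hreg fun _ => i]
      exact hreg' fun _ => i
    subst hdd
    have hcast : (((d + 1) ^ k - 1 : ℕ) : ℝ) = D ^ k - 1 := by
      rw [Nat.cast_sub (Nat.one_le_pow _ _ (by omega))]
      push_cast
      rfl
    rw [hcast] at hle
    -- The Ramanujan bound would be at least `ρ ^ k > 1` times itself, although it is positive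
    -- because `D ^ k ≥ 4`.
    have h1 := (hfinal k hk).trans hle
    have h2 : D ^ 2 ≤ D ^ k := pow_le_pow_right₀ (by linarith) (by omega)
    have h3 : 0 < √(D ^ k - 1 - 1) := Real.sqrt_pos.mpr (by nlinarith)
    have h4 : 1 < ρ ^ k := one_lt_pow₀ hρ1 (by omega)
    nlinarith

/-! ### Self-complementary vertex-transitive graphs and their thresholds -/

theorem IsVertexTransitive.exists_isRegularOfDegree [Fintype V] [Nonempty V] {G : SimpleGraph V}
    [DecidableRel G.Adj] (hG : G.IsVertexTransitive) : ∃ d, G.IsRegularOfDegree d := by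
  obtain ⟨i⟩ := ‹Nonempty V›
  refine ⟨G.degree i, fun j => ?_⟩
  obtain ⟨φ, rfl⟩ := hG i j
  exact φ.degree_eq i

theorem IsSelfComplementary.connected [Nonempty V] {G : SimpleGraph V}
    (hG : G.IsSelfComplementary) : G.Connected := by
  obtain ⟨σ⟩ := hG
  exact G.connected_or_connected_compl.elim id σ.connected_iff.mpr

/-- A regular self-complementary graph has `4 e + 1` vertices and valency `2 e`. -/
theorem IsSelfComplementary.exists_card_eq [Fintype V] [Nonempty V] {G : SimpleGraph V}
    [DecidableRel G.Adj] (hG : G.IsSelfComplementary) {d : ℕ} (hd : G.IsRegularOfDegree d) :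
    ∃ e, d = 2 * e ∧ Fintype.card V = 4 * e + 1 := by
  classical
  obtain ⟨σ⟩ := hG
  obtain ⟨i⟩ := id ‹Nonempty V›
  have h1 : d = Fintype.card V - 1 - d := by
    have := σ.degree_eq i
    rw [hd i, hd.compl (σ i)] at this
    exact this.symm
  have hn : 0 < Fintype.card V := Fintype.card_pos
  have h2 := G.sum_degrees_eq_twice_card_edges
  simp only [hd.degree_eq, Finset.sum_const, Finset.card_univ, smul_eq_mul] at h2
  have hcard : Fintype.card V = 2 * d + 1 := by omega
  -- Handshaking makes `n * d` even; as `n = 2 * d + 1` is odd, `d` is even.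
  have heven : Even (Fintype.card V * d) := by rw [h2]; exact even_two_mul _
  rw [Nat.even_mul, hcard] at heven
  have : Even d := heven.resolve_left (by simp)
  obtain ⟨e, rfl⟩ := this
  exact ⟨e, by omega, by omega⟩

/-- With `θ = √n` the hypothesis on `θ` reduces to `d + 1 < n`. -/
theorem sqrt_lt_div_sqrt {n D : ℝ} (hD : 0 < D) (h : D < n) : √n < n / √D := by
  rw [lt_div_iff₀ (by positivity), ← Real.sqrt_mul (by linarith), Real.sqrt_lt' (by linarith)]
  nlinarith

/-- With `θ = √n` the square of the base in the threshold inequality is `n / D`, so its even powers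
are rational. -/
theorem sq_div_sqrt_mul_sqrt {n D : ℝ} (hn : 0 < n) (hD : 0 < D) :
    (n / (√n * √D)) ^ 2 = n / D := by
  rw [div_pow, mul_pow, Real.sq_sqrt hn.le, Real.sq_sqrt hD.le]
  field_simp

/-- The inequality of `ramanujanThreshold_le_iff` holds at `5` and fails at `4`. The failure is by
less than one percent, so it needs the upper bound `√3 ≤ 1.75`. -/
theorem ramanujanThreshold_five : ramanujanThreshold 5 2 √5 = 5 := by
  have hlt : √5 < ((5 : ℕ) : ℝ) / √(((2 : ℕ) : ℝ) + 1) := by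
    have := sqrt_lt_div_sqrt (n := 5) (D := 3) (by norm_num) (by norm_num)
    norm_num at this ⊢
    exact this
  have hiff := fun k => ramanujanThreshold_le_iff (n := 5) (d := 2) (k := k) (by norm_num)
    (by positivity) hlt
  have hD : (2 : ℝ) + 1 = 3 := by norm_num
  have hr := sq_div_sqrt_mul_sqrt (n := 5) (D := 3) (by norm_num) (by norm_num)
  simp only [Nat.cast_ofNat, hD] at hiff
  have hr0 : 0 ≤ 5 / (√5 * √3) := by positivity
  set r := 5 / (√5 * √3)
  have ha : 1 ≤ √3 := Real.one_le_sqrt.mpr (by norm_num)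
  have ha2 : √3 ≤ 1.75 := Real.sqrt_le_iff.mpr (by norm_num)
  have ha3 : √3 ^ 3 = 3 * √3 := by rw [pow_succ, Real.sq_sqrt (by norm_num)]
  rw [ha3] at hiff
  have hr4 : r ^ 4 = 25 / 9 := by rw [show r ^ 4 = (r ^ 2) ^ 2 by ring, hr]; norm_num
  refine le_antisymm ((hiff 5).mpr ⟨by norm_num, ?_⟩) ?_
  · have h1 : 1.25 ≤ r := by nlinarith
    have h2 : (3 * √3)⁻¹ ≤ 1 / 3 := by
      rw [one_div]
      exact inv_anti₀ (by norm_num) (by linarith)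
    generalize (3 * √3)⁻¹ = x at h2
    rw [show r ^ 5 = r ^ 4 * r by ring, hr4]
    norm_num
    linarith
  · by_contra hcon
    have h := ((hiff 4).mp (by omega)).2
    have h2 : (5.25 : ℝ)⁻¹ ≤ (3 * √3)⁻¹ := inv_anti₀ (by positivity) (by linarith)
    generalize (3 * √3)⁻¹ = x at h h2
    rw [hr4] at h
    norm_num at h h2
    linarith

theorem ramanujanThreshold_nine : ramanujanThreshold 9 4 √9 = 4 := by
  have hlt : √9 < ((9 : ℕ) : ℝ) / √(((4 : ℕ) : ℝ) + 1) := by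
    have := sqrt_lt_div_sqrt (n := 9) (D := 5) (by norm_num) (by norm_num)
    norm_num at this ⊢
    exact this
  have hiff := fun k => ramanujanThreshold_le_iff (n := 9) (d := 4) (k := k) (by norm_num)
    (by positivity) hlt
  have hD : (4 : ℝ) + 1 = 5 := by norm_num
  have hr := sq_div_sqrt_mul_sqrt (n := 9) (D := 5) (by norm_num) (by norm_num)
  simp only [Nat.cast_ofNat, hD] at hiff
  have hr0 : 0 ≤ 9 / (√9 * √5) := by positivity
  set r := 9 / (√9 * √5)
  have ha : 1 ≤ √5 := Real.one_le_sqrt.mpr (by norm_num)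
  have ha2 : √5 ≤ 2.25 := Real.sqrt_le_iff.mpr (by norm_num)
  have ha3 : √5 ^ 3 = 5 * √5 := by rw [pow_succ, Real.sq_sqrt (by norm_num)]
  rw [ha3] at hiff
  have hr4 : r ^ 4 = 81 / 25 := by rw [show r ^ 4 = (r ^ 2) ^ 2 by ring, hr]; norm_num
  refine le_antisymm ((hiff 4).mpr ⟨by norm_num, ?_⟩) ?_
  · have h2 : (5 * √5)⁻¹ ≤ 1 / 5 := by
      rw [one_div]
      exact inv_anti₀ (by norm_num) (by linarith)
    generalize (5 * √5)⁻¹ = x at h2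
    rw [hr4]
    norm_num
    linarith
  · by_contra hcon
    have h := ((hiff 3).mp (by omega)).2
    have h1 : r ≤ 1.35 := by nlinarith
    have h2 : (11.25 : ℝ)⁻¹ ≤ (5 * √5)⁻¹ := inv_anti₀ (by positivity) (by linarith)
    generalize (5 * √5)⁻¹ = x at h h2
    rw [show r ^ 3 = r ^ 2 * r by ring, hr] at h
    norm_num at h h2
    linarith

/-- Here `n = 2 * D - 1` with `D ≥ 7`, so `n / D ≥ 13 / 7`, and the constants come from the extreme
case: `1854 = 13 ^ 3 - 7 ^ 3`, `18.2 = 7 * 2.6` with `2.6 ≤ √7`, and `1.36 ^ 2 ≤ 13 / 7`. -/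
theorem ramanujanThreshold_of_thirteen_le {n d : ℕ} (hn : n = 2 * d + 1) (hd : 6 ≤ d) :
    ramanujanThreshold n d √n = 3 := by
  have hdR : (6 : ℝ) ≤ d := by exact_mod_cast hd
  have hnR : (n : ℝ) = 2 * ((d : ℝ) + 1) - 1 := by rw [hn]; push_cast; ring
  have hlt : √(n : ℝ) < (n : ℝ) / √((d : ℝ) + 1) :=
    sqrt_lt_div_sqrt (by linarith) (by linarith)
  refine le_antisymm ((ramanujanThreshold_le_iff (by omega)
    (Real.sqrt_pos.mpr (by linarith)) hlt).mpr ⟨le_rfl, ?_⟩) (le_max_left _ _)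
  have hr := sq_div_sqrt_mul_sqrt (n := n) (D := (d : ℝ) + 1) (by linarith) (by linarith)
  have hr0 : 0 ≤ (n : ℝ) / (√n * √((d : ℝ) + 1)) := by positivity
  set r := (n : ℝ) / (√n * √((d : ℝ) + 1))
  set D := (d : ℝ) + 1
  have hD : 7 ≤ D := by simp only [D]; linarith
  have ha : 2.6 ≤ √D := Real.le_sqrt_of_sq_le (by norm_num; linarith)
  have hA : (√D ^ 3)⁻¹ ≤ (18.2 : ℝ)⁻¹ := by
    refine inv_anti₀ (by norm_num) ?_
    rw [pow_succ, Real.sq_sqrt (by linarith)]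
    nlinarith
  have hcube : (13 * D) ^ 3 ≤ (7 * (n : ℝ)) ^ 3 :=
    pow_le_pow_left₀ (by linarith) (by linarith) 3
  have hnpos : 0 < (n : ℝ) ^ 3 := by
    have : (0 : ℝ) < n := by linarith
    positivity
  have hsub : 0 ≤ (n : ℝ) ^ 3 - D ^ 3 := by nlinarith
  have hB : (n : ℝ) ^ 3 / ((n : ℝ) ^ 3 - D ^ 3) ≤ 2197 / 1854 := by
    rw [div_le_div_iff₀ (by nlinarith) (by norm_num)]
    nlinarith
  have hr2 : 13 / 7 ≤ r ^ 2 := by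
    rw [hr, div_le_div_iff₀ (by norm_num) (by linarith)]
    linarith
  have hr1 : 1.36 ≤ r := by nlinarith
  have hD3 : 0 ≤ (√D ^ 3)⁻¹ := by positivity
  calc (2 + (√D ^ 3)⁻¹) * ((n : ℝ) ^ 3 / ((n : ℝ) ^ 3 - D ^ 3))
      ≤ (2 + (18.2 : ℝ)⁻¹) * (2197 / 1854) := by gcongr
    _ ≤ 13 / 7 * 1.36 := by norm_num
    _ ≤ r ^ 2 * r := by gcongr
    _ = r ^ 3 := by ring

theorem not_isRamanujan_of_subsingleton {W : Type*} [Fintype W] [Subsingleton W]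
    (G : SimpleGraph W) : ¬ G.IsRamanujan := by
  rintro ⟨d, hd, hc, hreg, -⟩
  obtain ⟨i⟩ := hc.nonempty
  have := hreg i
  rw [degree_eq_zero_of_subsingleton] at this
  omega

end SimpleGraph

/-! ### The proposition -/

theorem mainTheorem6 {V : Type*} [Fintype V] (G : SimpleGraph V) [DecidableRel G.Adj] :
    (∀ d : ℕ, G.Connected → G.IsRegularOfDegree d → G ≠ ⊥ → G ≠ ⊤ →
      G.lovaszTheta < (Fintype.card V : ℝ) / Real.sqrt ((d : ℝ) + 1) →
      G.StrongPowersHighlyNonRamanujan d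
        (SimpleGraph.ramanujanThreshold (Fintype.card V) d G.lovaszTheta)) ∧
    (G.IsSelfComplementary → G.IsVertexTransitive →
      (Fintype.card V = 1 → ∀ k, 1 ≤ k → ¬ (G.strongPower k).IsRamanujan) ∧
      (1 < Fintype.card V → ∃ d k₀ : ℕ,
        G.Connected ∧ G.IsRegularOfDegree d ∧ G ≠ ⊥ ∧ G ≠ ⊤ ∧
        G.lovaszTheta < (Fintype.card V : ℝ) / Real.sqrt ((d : ℝ) + 1) ∧
        k₀ = SimpleGraph.ramanujanThreshold (Fintype.card V) d G.lovaszTheta ∧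
        ((Fintype.card V = 5 ∧ k₀ = 5) ∨ (Fintype.card V = 9 ∧ k₀ = 4) ∨
          (13 ≤ Fintype.card V ∧ Fintype.card V % 4 = 1 ∧ k₀ = 3)) ∧
        G.StrongPowersHighlyNonRamanujan d k₀)) := by
  refine ⟨fun d hc hG hbot htop hθ =>
    SimpleGraph.stronglyNonRamanujan_of_lovaszTheta_lt hc hG hbot htop hθ, fun hsc hvt =>
    ⟨fun h1 k _ => ?_, fun hn => ?_⟩⟩
  · have : Subsingleton V := Fintype.card_le_one_iff_subsingleton.mp h1.le
    exact SimpleGraph.not_isRamanujan_of_subsingleton _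
  · have : Nonempty V := Fintype.card_pos_iff.mp (by omega)
    have hc := hsc.connected
    obtain ⟨d, hd⟩ := hvt.exists_isRegularOfDegree
    obtain ⟨e, rfl, hcard⟩ := hsc.exists_card_eq hd
    have hθ := hsc.lovaszTheta_eq hvt
    have hnt : Nontrivial V := Fintype.one_lt_card_iff_nontrivial.mp hn
    obtain ⟨i, j, hij⟩ := hnt
    have htop : G ≠ ⊤ := by
      rintro rfl
      obtain ⟨σ⟩ := hsc
      simpa using σ.map_adj_iff.mpr ((SimpleGraph.top_adj i j).mpr hij)
    have hbot : G ≠ ⊥ := by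
      rintro rfl
      obtain ⟨σ⟩ := hsc
      simpa using σ.symm.map_adj_iff.mpr
        ((SimpleGraph.compl_adj ⊥ i j).mpr ⟨hij, by simp⟩)
    have hlt : G.lovaszTheta < (Fintype.card V : ℝ) / √(((2 * e : ℕ) : ℝ) + 1) := by
      rw [hθ]
      refine SimpleGraph.sqrt_lt_div_sqrt (by positivity) ?_
      exact_mod_cast (by omega : 2 * e + 1 < Fintype.card V)
    refine ⟨2 * e, _, hc, hd, hbot, htop, hlt, rfl, ?_,
      SimpleGraph.stronglyNonRamanujan_of_lovaszTheta_lt hc hd hbot htop hlt⟩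
    rw [hθ]
    obtain rfl | rfl | he : e = 1 ∨ e = 2 ∨ 3 ≤ e := by omega
    · refine Or.inl ⟨hcard, ?_⟩
      rw [hcard]
      simpa using SimpleGraph.ramanujanThreshold_five
    · refine Or.inr (Or.inl ⟨hcard, ?_⟩)
      rw [hcard]
      simpa using SimpleGraph.ramanujanThreshold_nine
    · exact Or.inr (Or.inr ⟨by omega, by omega,
        SimpleGraph.ramanujanThreshold_of_thirteen_le (by omega) (by omega)⟩)
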